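/- Let $X$ be a (real) Banach lattice having weakly sequentially continuous lattice operations, that is, $x_n\vee y_n\to x\vee y$ weakly in $X$ whenever $(x_n)$ and $(y_n)$ are sequences in $X$ converging weakly to $x$ and $y$, respectively. Then $X$ is LWCG (there is a weakly compact set $K\subset X$ such that the smallest norm-closed linear sublattice of $X$ containing $K$, i.e. the smallest norm-closed linear subspace that contains $K$ and is closed under $\vee$ and $\wedge$, is $X$ itself) if and only if $X$ is WCG (there is a weakly compact set $K\subset X$ whose closed linear span is $X$). -/

import Mathlib

open Filter Topology

section BanachSpace

variable {X : Type*} [NormedAddCommGroup X] [NormedSpace ℝ X]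

/-- `K` is compact for the weak topology of `X`. -/
def IsWeaklyCompact (K : Set X) : Prop :=
  IsCompact (toWeakSpace ℝ X '' K)

/-- The sequence `x` converges to `a` in the weak topology of `X`. -/
def WeaklyConvergesTo (x : ℕ → X) (a : X) : Prop :=
  Tendsto (fun n => toWeakSpace ℝ X (x n)) atTop (𝓝 (toWeakSpace ℝ X a))

variable (X) in
/-- `X` is weakly compactly generated: it is the closed linear span of a weakly compact set. -/
def IsWCG : Prop :=
  ∃ K : Set X, IsWeaklyCompact K ∧ (Submodule.span ℝ K).topologicalClosure = ⊤

end BanachSpace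

section BanachLattice

variable {X : Type*} [NormedAddCommGroup X] [NormedSpace ℝ X] [Lattice X]

/-- A norm closed linear subspace of `X` that is closed under `⊔` and `⊓`. -/
structure IsClosedSublattice (Y : Submodule ℝ X) : Prop where
  isClosed : IsClosed (Y : Set X)
  sup_mem : ∀ ⦃x y : X⦄, x ∈ Y → y ∈ Y → x ⊔ y ∈ Y
  inf_mem : ∀ ⦃x y : X⦄, x ∈ Y → y ∈ Y → x ⊓ y ∈ Y

/-- `L(A)`, the intersection of all closed sublattices of `X` that contain `A`. -/
def closedSublatticeSpan (A : Set X) : Submodule ℝ X :=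
  sInf {Y : Submodule ℝ X | IsClosedSublattice Y ∧ A ⊆ Y}

/-- `L(A)` is the smallest closed sublattice of `X` containing `A`. -/
theorem isLeast_closedSublatticeSpan (A : Set X) :
    IsLeast {Y : Submodule ℝ X | IsClosedSublattice Y ∧ A ⊆ Y} (closedSublatticeSpan A) := by
  refine ⟨⟨⟨?_, ?_, ?_⟩, ?_⟩, fun Y hY => sInf_le hY⟩
  · rw [closedSublatticeSpan, Submodule.coe_sInf]
    exact isClosed_biInter fun Y hY => hY.1.isClosed
  · intro x y hx hy
    simp only [closedSublatticeSpan, Submodule.mem_sInf] at hx hy ⊢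
    exact fun Y hY => hY.1.sup_mem (hx Y hY) (hy Y hY)
  · intro x y hx hy
    simp only [closedSublatticeSpan, Submodule.mem_sInf] at hx hy ⊢
    exact fun Y hY => hY.1.inf_mem (hx Y hY) (hy Y hY)
  · intro x hx
    simp only [closedSublatticeSpan, SetLike.mem_coe, Submodule.mem_sInf]
    exact fun Y hY => hY.2 hx

variable (X) in
/-- `X` is weakly compactly generated as a lattice: `X = L(K)` for a weakly compact set `K`. -/
def IsLWCG : Prop :=
  ∃ K : Set X, IsWeaklyCompact K ∧ closedSublatticeSpan K = ⊤

variable (X) in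
/-- `X` has weakly sequentially continuous lattice operations. (The statement for `⊓` follows
from the one for `⊔`, because `x ⊓ y = -(-x ⊔ -y)`.) -/
def HasWeaklySeqContinuousLatticeOps : Prop :=
  ∀ (x y : ℕ → X) (a b : X), WeaklyConvergesTo x a → WeaklyConvergesTo y b →
    WeaklyConvergesTo (fun n => x n ⊔ y n) (a ⊔ b)

end BanachLattice

/-! Only LWCG implies WCG needs work, since a closed sublattice is in particular a closed subspace.
Weakly compact sets are Fréchet-Urysohn for the weak topology, so a weakly sequentially continuous
map is weakly continuous on them and preserves weak compactness; this applies to `⊔` on products.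
Alternating bounded scalings, sums and suprema then exhausts a dense linear sublattice by countably
many weakly compact sets. Scaled to be norm null, these unite with `0` into one weakly compact
generating set. -/

section WeakTopology

variable {E F : Type*} [NormedAddCommGroup E] [NormedSpace ℝ E] [NormedAddCommGroup F]
  [NormedSpace ℝ F]

/-- A continuous linear functional is continuous for the weak topology. -/
theorem continuous_dual_toWeakSpace_symm (f : StrongDual ℝ E) :
    Continuous fun w : WeakSpace ℝ E => f ((toWeakSpace ℝ E).symm w) :=
  WeakBilin.eval_continuous (topDualPairing ℝ E).flip f

/-- A finite-dimensional subspace is normed, up to a factor `2`, by finitely many functionals of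
norm at most one. -/
theorem exists_finset_norming (V : Submodule ℝ E) [FiniteDimensional ℝ V] :
    ∃ T : Finset (StrongDual ℝ E), (∀ f ∈ T, ‖f‖ ≤ 1) ∧ ∀ v ∈ V, ∃ f ∈ T, ‖v‖ ≤ 2 * |f v| := by
  classical
  choose g hg hgv using fun v : E => exists_dual_vector'' ℝ v
  obtain ⟨t, -, ht⟩ := (isCompact_sphere (0 : V) 1).elim_nhds_subcover
    (fun v : V => {w : V | 1 / 2 < |g v w|}) fun v hv => by
      refine (isOpen_lt continuous_const (by fun_prop)).mem_nhds ?_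
      have hv' : ‖(v : E)‖ = 1 := by simpa using hv
      simp only [Set.mem_ofPred_eq, hgv, hv']
      norm_num
  -- The functional `0` serves `v = 0`, as `t` may be empty when `V` is trivial.
  refine ⟨insert 0 (t.image fun v : V => g v), ?_, fun v hv => ?_⟩
  · simp only [Finset.mem_insert, Finset.mem_image, forall_eq_or_imp, norm_zero, zero_le_one,
      true_and]
    rintro _ ⟨v, -, rfl⟩
    exact hg v
  · rcases eq_or_ne v 0 with rfl | hv0
    · exact ⟨0, by simp, by simp⟩
    have hpos : 0 < ‖v‖ := norm_pos_iff.2 hv0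
    have hw : (‖v‖⁻¹ • ⟨v, hv⟩ : V) ∈ Metric.sphere (0 : V) 1 := by
      simp [norm_smul, hpos.ne']
    obtain ⟨u, hu, hlt⟩ := Set.mem_iUnion₂.1 (ht hw)
    refine ⟨g u, Finset.mem_insert_of_mem (Finset.mem_image.2 ⟨u, hu, rfl⟩), ?_⟩
    simp only [Set.mem_ofPred_eq, Submodule.coe_smul, map_smul, smul_eq_mul, abs_mul, abs_inv,
      abs_norm] at hlt
    rw [inv_mul_eq_div, lt_div_iff₀ hpos] at hlt
    linarith

/-- A weak neighbourhood of `x` meets `A` whenever `x` is in the weak closure of `A`, so that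
finitely many functionals can be approximated at `x` along `A`. -/
theorem exists_mem_forall_abs_sub_lt {A : Set E} {x : E}
    (hx : toWeakSpace ℝ E x ∈ closure (toWeakSpace ℝ E '' A)) (T : Finset (StrongDual ℝ E))
    {ε : ℝ} (hε : 0 < ε) : ∃ a ∈ A, ∀ f ∈ T, |f a - f x| < ε := by
  have hU : (⋂ f ∈ T, {w : WeakSpace ℝ E | |f ((toWeakSpace ℝ E).symm w) - f x| < ε}) ∈
      𝓝 (toWeakSpace ℝ E x) := by
    refine (Filter.biInter_finset_mem T).2 fun f _ => ?_
    have hc := continuous_dual_toWeakSpace_symm f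
    exact (isOpen_lt (hc.sub continuous_const).abs continuous_const).mem_nhds (by simpa using hε)
  obtain ⟨_, hw, a, ha, rfl⟩ := mem_closure_iff_nhds.1 hx _ hU
  exact ⟨a, ha, fun f hf => by simpa using Set.mem_iInter₂.1 hw f hf⟩

/-- A weakly compact set has the Fréchet-Urysohn property for the weak topology. -/
theorem IsWeaklyCompact.exists_seq_weaklyConvergesTo {K A : Set E} (hK : IsWeaklyCompact K)
    (hA : A ⊆ K) {x : E} (hx : toWeakSpace ℝ E x ∈ closure (toWeakSpace ℝ E '' A)) :
    ∃ a : ℕ → E, (∀ n, a n ∈ A) ∧ WeaklyConvergesTo a x := by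
  classical
  choose N hN1 hN2 using fun S : Finset E =>
    exists_finset_norming (Submodule.span ℝ (S : Set E))
  choose p hpA hp using fun (n : ℕ) (T : Finset (StrongDual ℝ E)) =>
    exists_mem_forall_abs_sub_lt hx T (Nat.one_div_pos_of_nat (α := ℝ) (n := n))
  -- Stage `n` holds `x` and the points chosen so far, with functionals norming their span; `a n`
  -- matches `x` on these functionals up to `1 / (n + 1)`.
  let st : ℕ → Finset E × Finset (StrongDual ℝ E) := fun n => n.rec ({x}, N {x}) fun k q =>
    (insert (p k q.2) q.1, q.2 ∪ N (insert (p k q.2) q.1))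
  let a : ℕ → E := fun n => p n (st n).2
  have hS : ∀ n, (st (n + 1)).1 = insert (a n) (st n).1 := fun n => rfl
  have hT : ∀ n, (st (n + 1)).2 = (st n).2 ∪ N (st (n + 1)).1 := fun n => rfl
  have hSm : Monotone fun n => (st n).1 := monotone_nat_of_le_succ fun n => by
    rw [hS]; exact Finset.subset_insert _ _
  have hTm : Monotone fun n => (st n).2 := monotone_nat_of_le_succ fun n => by
    rw [hT]; exact Finset.subset_union_left
  have hNT : ∀ n, N (st n).1 ⊆ (st n).2
    | 0 => subset_rfl
    | n + 1 => by rw [hT]; exact Finset.subset_union_right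
  have hT1 : ∀ n, ∀ f ∈ (st n).2, ‖f‖ ≤ 1 := by
    intro n
    induction n with
    | zero => exact hN1 _
    | succ n ih =>
      rw [hT]
      intro f hf
      exact (Finset.mem_union.1 hf).elim (ih f) (hN1 _ f)
  have hlim : ∀ n, ∀ f ∈ (st n).2, Tendsto (fun k => f (a k)) atTop (𝓝 (f x)) := by
    intro n f hf
    refine tendsto_iff_norm_sub_tendsto_zero.2 ?_
    refine squeeze_zero' (.of_forall fun _ => norm_nonneg _) ?_ tendsto_one_div_add_atTop_nhds_zero_nat
    filter_upwards [eventually_ge_atTop n] with k hk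
    exact (hp k _ f (hTm hk hf)).le
  let V : ℕ → Submodule ℝ E := fun n => Submodule.span ℝ ((st n).1 : Set E)
  have hVm : Monotone V := fun m n h => Submodule.span_mono (Finset.coe_subset.2 (hSm h))
  have hVmem : ∀ v, v ∈ ⨆ n, V n ↔ ∃ n, v ∈ V n := fun v =>
    Submodule.mem_iSup_of_directed V hVm.directed_le
  have hx0 : x ∈ V 0 := Submodule.subset_span (by simp [st])
  have haV : ∀ n, a n ∈ ⨆ n, V n := fun n =>
    (hVmem _).2 ⟨n + 1, Submodule.subset_span (by simp [hS])⟩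
  refine ⟨a, fun n => hpA _ _, IsCompact.tendsto_nhds_of_unique_mapClusterPt hK
    (.of_forall fun n => ⟨a n, hA (hpA _ _), rfl⟩) ?_⟩
  rintro _ ⟨y, -, rfl⟩ hy
  -- Mazur: the weak and norm closures of a subspace agree.
  have hycl : y ∈ closure ((⨆ n, V n : Submodule ℝ E) : Set E) := by
    have h1 : toWeakSpace ℝ E y ∈
        closure (toWeakSpace ℝ E '' ((⨆ n, V n : Submodule ℝ E) : Set E)) :=
      hy.mem_closure_of_mem _ (mem_map.2 <| univ_mem' fun n => ⟨a n, haV n, rfl⟩)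
    rw [← (Submodule.convex _).toWeakSpace_closure ℝ] at h1
    obtain ⟨z, hz, hzy⟩ := h1
    rwa [(toWeakSpace ℝ E).injective hzy] at hz
  have hyx : y - x ∈ (⨆ n, V n).topologicalClosure :=
    sub_mem hycl (Submodule.le_topologicalClosure _ ((hVmem x).2 ⟨0, hx0⟩))
  have hfy : ∀ n, ∀ f ∈ (st n).2, f (y - x) = 0 := by
    intro n f hf
    have h1 : MapClusterPt (f y) atTop (fun k => f (a k)) := by
      simpa [Function.comp_def] using
        hy.continuousAt_comp (continuous_dual_toWeakSpace_symm f).continuousAt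
    have h2 : f y = f x := by
      have : (𝓝 (f y) ⊓ 𝓝 (f x)).NeBot := h1.neBot.mono (inf_le_inf_left _ (hlim n f hf))
      exact eq_of_nhds_neBot this
    simp [h2]
  congr 1
  refine sub_eq_zero.1 (norm_le_zero_iff.1 (le_of_forall_pos_le_add fun ε hε => ?_))
  -- As `f` vanishes at `y - x`, `‖v‖ ≤ 2 * ‖y - x - v‖`, so `‖y - x‖ ≤ 3 * ‖y - x - v‖`.
  obtain ⟨v, hv, hlt⟩ := Metric.mem_closure_iff.1 hyx (ε / 3) (by positivity)
  obtain ⟨n, hn⟩ := (hVmem v).1 hv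
  obtain ⟨f, hf, hfv⟩ := hN2 _ v hn
  have h0 := hfy n f (hNT n hf)
  rw [dist_eq_norm] at hlt
  have h3 : |f v| ≤ ‖y - x - v‖ := by
    calc |f v| = ‖f (y - x - v)‖ := by rw [map_sub, h0, zero_sub, norm_neg, Real.norm_eq_abs]
      _ ≤ ‖y - x - v‖ := f.le_of_opNorm_le_of_le (hN1 _ f hf) le_rfl |>.trans_eq (one_mul _)
  have h4 : ‖y - x‖ ≤ ‖y - x - v‖ + ‖v‖ := by simpa using norm_add_le (y - x - v) v
  linarith

/-- A weakly sequentially continuous map sends weakly compact sets to weakly compact sets. -/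
theorem IsWeaklyCompact.image_of_weaklySeqContinuous {K : Set E} (hK : IsWeaklyCompact K)
    (φ : E → F) (hφ : ∀ (x : ℕ → E) (a : E), WeaklyConvergesTo x a →
      WeaklyConvergesTo (fun n => φ (x n)) (φ a)) : IsWeaklyCompact (φ '' K) := by
  let ψ : WeakSpace ℝ E → WeakSpace ℝ F :=
    fun w => toWeakSpace ℝ F (φ ((toWeakSpace ℝ E).symm w))
  have hψ : toWeakSpace ℝ F '' (φ '' K) = ψ '' (toWeakSpace ℝ E '' K) := by
    simp [Set.image_image, ψ]
  rw [IsWeaklyCompact, hψ]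
  refine IsCompact.image_of_continuousOn hK (continuousOn_iff_isClosed.2 fun C hC => ?_)
  refine ⟨closure (ψ ⁻¹' C ∩ toWeakSpace ℝ E '' K), isClosed_closure, ?_⟩
  refine Set.Subset.antisymm (fun w hw => ⟨subset_closure hw, hw.2⟩) ?_
  rintro _ ⟨hw, ⟨x, hx, rfl⟩⟩
  refine ⟨?_, ⟨x, hx, rfl⟩⟩
  have hA : ψ ⁻¹' C ∩ toWeakSpace ℝ E '' K =
      toWeakSpace ℝ E '' {y | y ∈ K ∧ toWeakSpace ℝ F (φ y) ∈ C} := by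
    ext w
    constructor
    · rintro ⟨h1, y, hy, rfl⟩
      exact ⟨y, ⟨hy, by simpa [ψ] using h1⟩, rfl⟩
    · rintro ⟨y, hy, rfl⟩
      exact ⟨by simpa [ψ] using hy.2, y, hy.1, rfl⟩
  rw [hA] at hw
  obtain ⟨a, ha, hax⟩ := hK.exists_seq_weaklyConvergesTo (fun y hy => hy.1) hw
  have := hC.mem_of_tendsto (hφ a x hax) (.of_forall fun n => (ha n).2)
  simpa [ψ] using this

/-! ### Operations on weakly compact sets -/

theorem WeaklyConvergesTo.map {x : ℕ → E} {a : E} (h : WeaklyConvergesTo x a) (f : E →L[ℝ] F) :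
    WeaklyConvergesTo (fun n => f (x n)) (f a) :=
  ((WeakSpace.map f).continuous.tendsto _).comp h

theorem IsWeaklyCompact.union {K L : Set E} (hK : IsWeaklyCompact K) (hL : IsWeaklyCompact L) :
    IsWeaklyCompact (K ∪ L) := by
  rw [IsWeaklyCompact, Set.image_union]
  exact IsCompact.union hK hL

theorem isWeaklyCompact_singleton (x : E) : IsWeaklyCompact {x} := by
  rw [IsWeaklyCompact, Set.image_singleton]
  exact isCompact_singleton

/-- The product of weakly compact sets is weakly compact. -/
theorem IsWeaklyCompact.prod {K : Set E} {L : Set F} (hK : IsWeaklyCompact K)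
    (hL : IsWeaklyCompact L) : IsWeaklyCompact (K ×ˢ L) := by
  have hc : Continuous fun q : WeakSpace ℝ E × WeakSpace ℝ F =>
      WeakSpace.map (ContinuousLinearMap.inl ℝ E F) q.1 +
        WeakSpace.map (ContinuousLinearMap.inr ℝ E F) q.2 :=
    ((WeakSpace.map _).continuous.comp continuous_fst).add
      ((WeakSpace.map _).continuous.comp continuous_snd)
  have h := (IsCompact.prod hK hL).image hc
  rw [IsWeaklyCompact]
  convert h using 1
  ext w
  constructor
  · rintro ⟨⟨x, y⟩, ⟨hx, hy⟩, rfl⟩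
    refine ⟨(toWeakSpace ℝ E x, toWeakSpace ℝ F y), ⟨⟨x, hx, rfl⟩, ⟨y, hy, rfl⟩⟩, ?_⟩
    change toWeakSpace ℝ (E × F) ((x, 0) + (0, y)) = _
    simp
  · rintro ⟨⟨_, _⟩, ⟨⟨x, hx, rfl⟩, ⟨y, hy, rfl⟩⟩, rfl⟩
    refine ⟨(x, y), ⟨hx, hy⟩, ?_⟩
    change _ = toWeakSpace ℝ (E × F) ((x, 0) + (0, y))
    simp

theorem IsWeaklyCompact.add {K L : Set E} (hK : IsWeaklyCompact K) (hL : IsWeaklyCompact L) :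
    IsWeaklyCompact (Set.image2 (fun x y => x + y) K L) := by
  rw [← Set.image_prod]
  exact (hK.prod hL).image_of_weaklySeqContinuous _ fun x a h =>
    h.map (ContinuousLinearMap.fst ℝ E E + ContinuousLinearMap.snd ℝ E E)

/-- Multiples of points of a weakly compact set by scalars from a compact set form a weakly
compact set. -/
theorem IsWeaklyCompact.smul {K : Set E} (hK : IsWeaklyCompact K) {S : Set ℝ} (hS : IsCompact S) :
    IsWeaklyCompact (Set.image2 (fun (s : ℝ) x => s • x) S K) := by
  have h := (hS.prod hK).image (f := fun q : ℝ × WeakSpace ℝ E => q.1 • q.2) (by fun_prop)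
  rw [IsWeaklyCompact]
  convert h using 1
  rw [Set.image_image2, Set.image_prod, Set.image2_image_right]
  rfl

/-- Weakly compact sets are norm bounded. -/
theorem IsWeaklyCompact.exists_norm_le {K : Set E} (hK : IsWeaklyCompact K) :
    ∃ C : ℝ, 0 < C ∧ ∀ x ∈ K, ‖x‖ ≤ C := by
  -- Uniform boundedness is applied on the dual, which is complete even if `E` is not.
  obtain ⟨C, hC⟩ := banach_steinhaus
    (g := fun x : K => NormedSpace.inclusionInDoubleDual ℝ E (x : E)) fun f => by
      obtain ⟨C, hC⟩ := hK.exists_bound_of_continuousOn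
        (continuous_dual_toWeakSpace_symm f).continuousOn
      exact ⟨C, fun x => by simpa using hC _ ⟨x, x.2, rfl⟩⟩
  refine ⟨max C 1, by positivity, fun x hx => le_max_of_le_left ?_⟩
  exact ((NormedSpace.inclusionInDoubleDualLi ℝ).norm_map x).symm.trans_le (hC ⟨x, hx⟩)

/-- If a set is the union of a norm null sequence of weakly compact sets and zero, then it is
weakly compact. -/
theorem isWeaklyCompact_insert_zero_iUnion {K : ℕ → Set E} (hK : ∀ n, IsWeaklyCompact (K n))
    {r : ℕ → ℝ} (hr : Tendsto r atTop (𝓝 0)) (hKr : ∀ n, ∀ x ∈ K n, ‖x‖ ≤ r n) :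
    IsWeaklyCompact (insert 0 (⋃ n, K n)) := by
  rw [IsWeaklyCompact, isCompact_iff_ultrafilter_le_nhds']
  intro f hf
  by_cases h0 : (f : Filter (WeakSpace ℝ E)) ≤ 𝓝 (toWeakSpace ℝ E 0)
  · exact ⟨_, ⟨0, Set.mem_insert _ _, rfl⟩, h0⟩
  obtain ⟨V, hV, hVf⟩ := Filter.not_le.1 h0
  have hV' : toWeakSpace ℝ E ⁻¹' V ∈ 𝓝 (0 : E) :=
    (toWeakSpaceCLM ℝ E).continuous.tendsto 0 hV
  obtain ⟨ε, hε, hball⟩ := Metric.mem_nhds_iff.1 hV'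
  obtain ⟨N, hN⟩ := eventually_atTop.1 (hr.eventually_lt_const hε)
  have hc : IsCompact (⋃ n ∈ Set.Iio N, toWeakSpace ℝ E '' K n) :=
    (Set.finite_Iio N).isCompact_biUnion fun n _ => hK n
  -- Off `V` norms are at least `ε`, which excludes `0` and every `K n` with `n ≥ N`.
  have hmem : (⋃ n ∈ Set.Iio N, toWeakSpace ℝ E '' K n) ∈ f := by
    refine mem_of_superset (inter_mem hf (Ultrafilter.compl_mem_iff_notMem.2 hVf)) ?_
    rintro _ ⟨⟨x, hx, rfl⟩, hxV⟩
    have hxε : ε ≤ ‖x‖ := by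
      by_contra! h
      exact hxV (hball (mem_ball_zero_iff.2 h))
    rcases hx with rfl | hx
    · simp at hxε; linarith
    obtain ⟨n, hn⟩ := Set.mem_iUnion.1 hx
    refine Set.mem_biUnion (x := n) ?_ ⟨x, hn, rfl⟩
    by_contra! h
    exact absurd (hN n (not_lt.1 h)) (not_lt.2 (hxε.trans (hKr n x hn)))
  obtain ⟨w, hw, hfw⟩ := isCompact_iff_ultrafilter_le_nhds'.1 hc f hmem
  obtain ⟨n, -, x, hx, rfl⟩ := Set.mem_iUnion₂.1 hw
  exact ⟨_, ⟨x, Set.mem_insert_of_mem _ (Set.mem_iUnion.2 ⟨n, hx⟩), rfl⟩, hfw⟩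

/-- A Banach space that is generated by countably many weakly compact sets is weakly compactly
generated. -/
theorem isWCG_of_iUnion {K : ℕ → Set E} (hK : ∀ n, IsWeaklyCompact (K n))
    (htop : (Submodule.span ℝ (⋃ n, K n)).topologicalClosure = ⊤) : IsWCG E := by
  choose C hC0 hC using fun n => (hK n).exists_norm_le
  let c : ℕ → ℝ := fun n => (C n)⁻¹ * (1 / ((n : ℝ) + 1))
  have hc : ∀ n, 0 < c n := fun n => mul_pos (inv_pos.2 (hC0 n)) Nat.one_div_pos_of_nat
  refine ⟨_, isWeaklyCompact_insert_zero_iUnion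
    (fun n => (hK n).smul (isCompact_singleton (x := c n)))
    tendsto_one_div_add_atTop_nhds_zero_nat ?_, ?_⟩
  · rintro n _ ⟨_, rfl, x, hx, rfl⟩
    rw [norm_smul, Real.norm_of_nonneg (hc n).le]
    calc c n * ‖x‖ ≤ c n * C n := mul_le_mul_of_nonneg_left (hC n x hx) (hc n).le
      _ = 1 / ((n : ℝ) + 1) := by
        have := (hC0 n).ne'
        simp only [c]
        field_simp
  · refine top_unique (htop ▸ Submodule.topologicalClosure_mono (Submodule.span_le.2 ?_))
    intro x hx
    obtain ⟨n, hn⟩ := Set.mem_iUnion.1 hx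
    have : c n • x ∈ Submodule.span ℝ
        (insert 0 (⋃ n, Set.image2 (fun (s : ℝ) x => s • x) {c n} (K n))) :=
      Submodule.subset_span (Set.mem_insert_of_mem _ (Set.mem_iUnion.2 ⟨n, _, rfl, x, hn, rfl⟩))
    simpa [smul_smul, (hc n).ne'] using Submodule.smul_mem _ (c n)⁻¹ this

end WeakTopology

/-! ### Generated sublattices -/

section BanachLattice

variable {X : Type*} [NormedAddCommGroup X] [NormedSpace ℝ X] [Lattice X]

theorem IsWCG.isLWCG (h : IsWCG X) : IsLWCG X := by
  obtain ⟨K, hK, hspan⟩ := h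
  refine ⟨K, hK, top_unique ?_⟩
  have hL := (isLeast_closedSublatticeSpan K).1
  rw [← hspan]
  exact Submodule.topologicalClosure_minimal _ (Submodule.span_le.2 hL.2) hL.1.isClosed

/-- The one place where weak sequential continuity of `⊔` does its work. -/
theorem IsWeaklyCompact.sup (hX : HasWeaklySeqContinuousLatticeOps X) {K L : Set X}
    (hK : IsWeaklyCompact K) (hL : IsWeaklyCompact L) :
    IsWeaklyCompact (Set.image2 (fun x y => x ⊔ y) K L) := by
  rw [← Set.image_prod]
  exact (hK.prod hL).image_of_weaklySeqContinuous _ fun x a h =>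
    hX _ _ _ _ (h.map (ContinuousLinearMap.fst ℝ X X)) (h.map (ContinuousLinearMap.snd ℝ X X))

/-- The closure of a subspace closed under `⊔` is a closed sublattice. -/
theorem isClosedSublattice_topologicalClosure [IsOrderedAddMonoid X] [HasSolidNorm X]
    {Y : Submodule ℝ X} (hY : ∀ x ∈ Y, ∀ y ∈ Y, x ⊔ y ∈ Y) :
    IsClosedSublattice Y.topologicalClosure := by
  have hsup : ∀ ⦃x y : X⦄, x ∈ Y.topologicalClosure → y ∈ Y.topologicalClosure →
      x ⊔ y ∈ Y.topologicalClosure := fun x y hx hy =>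
    map_mem_closure₂ continuous_sup hx hy hY
  refine ⟨Y.isClosed_topologicalClosure, hsup, fun x y hx hy => ?_⟩
  rw [← neg_neg (x ⊓ y), neg_inf]
  exact neg_mem (hsup (neg_mem hx) (neg_mem hy))

/-- The linear sublattice generated by a weakly compact set is a countable union of weakly compact
sets. -/
theorem exists_weaklyCompact_iUnion_submodule (hX : HasWeaklySeqContinuousLatticeOps X)
    {K : Set X} (hK : IsWeaklyCompact K) :
    ∃ (M : ℕ → Set X) (Y : Submodule ℝ X), (∀ n, IsWeaklyCompact (M n)) ∧
      (Y : Set X) = ⋃ n, M n ∧ K ⊆ Y ∧ ∀ x ∈ Y, ∀ y ∈ Y, x ⊔ y ∈ Y := by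
  -- The scalar intervals are compact, contain `0` and `1`, and exhaust `ℝ`: so `M` increases and
  -- its union absorbs all scalars.
  let D : ℕ → Set X → Set X := fun n S =>
    Set.image2 (fun (s : ℝ) x => s • x) (Set.Icc (-((n : ℝ) + 1)) (n + 1)) S
  let M : ℕ → Set X := fun n => n.rec (insert 0 K) fun k S =>
    Set.image2 (fun x y => x + y) (D k S) (D k S) ∪
      Set.image2 (fun x y => x ⊔ y) (D k S) (D k S)
  have hM : ∀ n, M (n + 1) = Set.image2 (fun x y => x + y) (D n (M n)) (D n (M n)) ∪
      Set.image2 (fun x y => x ⊔ y) (D n (M n)) (D n (M n)) := fun n => rfl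
  have hcomp : ∀ n, IsWeaklyCompact (M n) := by
    intro n
    induction n with
    | zero => exact (isWeaklyCompact_singleton 0).union hK
    | succ n ih =>
      have hD : IsWeaklyCompact (D n (M n)) := ih.smul isCompact_Icc
      rw [hM]
      exact (hD.add hD).union (hD.sup hX hD)
  have hsubD : ∀ n, M n ⊆ D n (M n) := fun n x hx =>
    ⟨1, ⟨by linarith [n.cast_nonneg (α := ℝ)], by linarith [n.cast_nonneg (α := ℝ)]⟩, x, hx,
      one_smul _ _⟩
  have h0D : ∀ n, (M n).Nonempty → 0 ∈ D n (M n) := fun n ⟨x, hx⟩ =>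
    ⟨0, ⟨by linarith [n.cast_nonneg (α := ℝ)], by linarith [n.cast_nonneg (α := ℝ)]⟩, x, hx,
      zero_smul _ _⟩
  have hDsub : ∀ n, D n (M n) ⊆ M (n + 1) := fun n x hx => by
    obtain ⟨_, _, z, hz, _⟩ := id hx
    exact .inl ⟨x, hx, 0, h0D n ⟨z, hz⟩, add_zero x⟩
  have hmono : Monotone M := monotone_nat_of_le_succ fun n => (hsubD n).trans (hDsub n)
  have hadd : ∀ n, ∀ x ∈ M n, ∀ y ∈ M n, x + y ∈ M (n + 1) := fun n x hx y hy =>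
    .inl ⟨x, hsubD n hx, y, hsubD n hy, rfl⟩
  have hsup : ∀ n, ∀ x ∈ M n, ∀ y ∈ M n, x ⊔ y ∈ M (n + 1) := fun n x hx y hy =>
    .inr ⟨x, hsubD n hx, y, hsubD n hy, rfl⟩
  have hcommon : ∀ {x y : X}, x ∈ ⋃ n, M n → y ∈ ⋃ n, M n → ∃ n, x ∈ M n ∧ y ∈ M n := by
    intro x y hx hy
    obtain ⟨m, hm⟩ := Set.mem_iUnion.1 hx
    obtain ⟨n, hn⟩ := Set.mem_iUnion.1 hy
    exact ⟨max m n, hmono (le_max_left _ _) hm, hmono (le_max_right _ _) hn⟩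
  refine ⟨M, { carrier := ⋃ n, M n, add_mem' := ?_, zero_mem' := ?_, smul_mem' := ?_ }, hcomp, rfl,
    ?_, ?_⟩
  · intro x y hx hy
    obtain ⟨n, hxn, hyn⟩ := hcommon hx hy
    exact Set.mem_iUnion.2 ⟨n + 1, hadd n x hxn y hyn⟩
  · exact Set.mem_iUnion.2 ⟨0, Set.mem_insert _ _⟩
  · intro c x hx
    obtain ⟨m, hm⟩ := Set.mem_iUnion.1 hx
    obtain ⟨k, hk⟩ := exists_nat_ge |c|
    have hc := abs_le.1 hk
    have hkm : (k : ℝ) ≤ (max m k : ℕ) := by exact_mod_cast le_max_right m k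
    exact Set.mem_iUnion.2 ⟨max m k + 1, hDsub _ ⟨c, ⟨by linarith, by linarith⟩, x,
      hmono (le_max_left _ _) hm, rfl⟩⟩
  · exact fun x hx => Set.mem_iUnion.2 ⟨0, Set.mem_insert_of_mem _ hx⟩
  · intro x hx y hy
    obtain ⟨n, hxn, hyn⟩ := hcommon hx hy
    exact Set.mem_iUnion.2 ⟨n + 1, hsup n x hxn y hyn⟩

theorem IsLWCG.isWCG [IsOrderedAddMonoid X] [HasSolidNorm X]
    (hX : HasWeaklySeqContinuousLatticeOps X) (h : IsLWCG X) : IsWCG X := by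
  obtain ⟨K, hK, htop⟩ := h
  obtain ⟨M, Y, hM, hYM, hKY, hsup⟩ := exists_weaklyCompact_iUnion_submodule hX hK
  refine isWCG_of_iUnion hM (top_unique ?_)
  rw [← hYM, Submodule.span_eq, ← htop]
  exact (isLeast_closedSublatticeSpan K).2
    ⟨isClosedSublattice_topologicalClosure hsup, hKY.trans Y.le_topologicalClosure⟩

end BanachLattice

theorem theorem2p2 {X : Type*} [NormedAddCommGroup X] [NormedSpace ℝ X] [CompleteSpace X]
    [Lattice X] [IsOrderedAddMonoid X] [IsOrderedModule ℝ X] [HasSolidNorm X]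
    (hX : HasWeaklySeqContinuousLatticeOps X) :
    IsLWCG X ↔ IsWCG X :=
  ⟨IsLWCG.isWCG hX, IsWCG.isLWCG⟩
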